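/- Consider a chemical system with $n$ species and $n_R$ reactions, with reactant and product stoichiometric coefficients $\nu^-_{i,r},\nu^+_{i,r}\in\mathbb Z_+$, state changes $\boldsymbol\nu_r=(\nu^+_{i,r}-\nu^-_{i,r})_{i}\in\mathbb Z^n$ and polynomial propensities $a_r\in\mathbb R[x_1,\dots,x_n]$. Let $P(\cdot,t)$, $t\ge 0$, be probability distributions on $\mathbb Z_+^n$ (extended by $0$ to $\mathbb Z^n$) with $P(\cdot,0)=\pi$ that satisfy the Chemical Master Equation $$\frac{\partial P}{\partial t}(x,t)=\sum_{r=1}^{n_R}\big(a_r(x-\boldsymbol\nu_r)P(x-\boldsymbol\nu_r,t)-a_r(x)P(x,t)\big),$$ and let $X=\{x\in\mathbb Z_+^n : \exists\, t\ge 0,\ P(x,t)>0\}$ be the reachable set. Put $q=\max\{0,\max_r \deg a_r-1\}$ and fix a truncation order $m\in\mathbb Z_+$. Vectors $\boldsymbol y=(y_{\boldsymbol k})_{|\boldsymbol k|\le m+q}$ are indexed by the multi-indices $\boldsymbol k\in\mathbb Z_+^n$ of order at most $m+q$. The moment ODE is the linear system $$\frac{dy_{\boldsymbol i}}{dt}(t)=\sum_{|\boldsymbol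 k|\le m+q}A_{\boldsymbol i\boldsymbol k}\,y_{\boldsymbol k}(t),\qquad |\boldsymbol i|\le m,$$ where $A_{\boldsymbol i\boldsymbol k}$ is the coefficient of $x^{\boldsymbol k}$ in $\sum_r a_r(x)\big((x+\boldsymbol\nu_r)^{\boldsymbol i}-x^{\boldsymbol i}\big)$. Let $f_0,\dots,f_{n_p}\in\mathbb R[x_1,\dots,x_n]$ be polynomials of degree at most $m+q$ that are non-negative on $X$. For $f=f_l$ let $M_f(\boldsymbol y)$ be the symmetric matrix indexed by the multi-indices $\boldsymbol a,\boldsymbol b$ of order at most $\lfloor (m+q-\deg f)/2\rfloor$ with entries $\sum_{\boldsymbol\gamma} f_{\boldsymbol\gamma}\,y_{\boldsymbol a+\boldsymbol b+\boldsymbol\gamma}$, where $f=\sum_{\boldsymbol\gamma}f_{\boldsymbol\gamma}x^{\boldsymbol\gamma}$, and let $C(X)=\{\boldsymbol y : M_{f_l}(\boldsymbol y)\succeq 0,\ l=0,\dots,n_p\}$. Let $t_T>0$, $t_f\in[0,t_T]$, $d\in\mathbb Z_+$, let $\boldsymbol j$ be a multi-index of order at most $m+q$, and let $\boldsymbol y_0$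 be a vector of initial values. Then the semi-infinite optimization problem $$\begin{aligned}\inf_{\boldsymbol y}\quad & y_{\boldsymbol j}(t_f)\\ \text{s.t.}\quad & \boldsymbol y=(y_{\boldsymbol k})_{|\boldsymbol k|\le m+q},\ \ y_{\boldsymbol k}\in\mathbb R[t],\ \deg y_{\boldsymbol k}\le d,\\ & \boldsymbol y \text{ satisfies the moment ODE for all } t\in[0,t_T],\\ & \boldsymbol y(0)=\boldsymbol y_0,\\ & \boldsymbol y(t)\in C(X)\quad\forall t\in[0,t_T]\end{aligned}$$ is equivalent to a finite semidefinite program: there are a semidefinite program with finitely many real variables $u\in\mathbb R^N$, a linear cost, finitely many affine equations and finitely many linear matrix inequalities $F_l^0+\sum_k u_kF_l^k\succeq0$ with real symmetric matrices of finite size, and a linear map from $\mathbb R^N$ to the vectors of polynomials $\boldsymbol y$, which maps the feasible set of the semidefinite program onto the feasible set of the problem above and preserves the objective value of each feasible point; in particular the two problems have the same infimum (in $[-\infty,\infty]$), and the set of optimal solutions of the semidefinite program is mapped onto the set of optimal solutions of the problem above. -/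

import Mathlib

/-! Reaction networks, moment equations, moment cones, and semidefinite programs. -/

/-- A chemical system with `n` species and `nR` reactions: the stoichiometric coefficients of
the reactants and of the products, and polynomial propensities. -/
structure ReactionNetwork (n nR : ℕ) where
  reactants : Fin n → Fin nR → ℕ
  products : Fin n → Fin nR → ℕ
  propensity : Fin nR → MvPolynomial (Fin n) ℝ

namespace ReactionNetwork

variable {n nR : ℕ}

/-- The change `ν_r ∈ ℤⁿ` of the state caused by reaction `r`. -/
def change (N : ReactionNetwork n nR) (r : Fin nR) : Fin n → ℤ :=
  fun i => (N.products i r : ℤ) - (N.reactants i r : ℤ)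

/-- The value `a_r(x)` of a propensity at a state. -/
noncomputable def rate (N : ReactionNetwork n nR) (r : Fin nR) (x : Fin n → ℤ) : ℝ :=
  MvPolynomial.eval (fun i => (x i : ℝ)) (N.propensity r)

/-- `P x t` is the probability of the state `x` at time `t ≥ 0`: at every time a probability
distribution on `ℤ₊ⁿ` (written as a function on `ℤⁿ` that vanishes outside `ℤ₊ⁿ`), with initial
distribution `init`, that satisfies the Chemical Master Equation. -/
structure IsCMESolution (N : ReactionNetwork n nR) (init : (Fin n → ℤ) → ℝ)
    (P : (Fin n → ℤ) → ℝ → ℝ) : Prop where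
  nonneg : ∀ x t, 0 ≤ t → 0 ≤ P x t
  eq_zero : ∀ x t, 0 ≤ t → ¬ 0 ≤ x → P x t = 0
  hasSum_one : ∀ t, 0 ≤ t → HasSum (fun x => P x t) 1
  initial : ∀ x, P x 0 = init x
  master_equation : ∀ x t, 0 ≤ x → 0 ≤ t →
    HasDerivWithinAt (P x)
      (∑ r, (N.rate r (x - N.change r) * P (x - N.change r) t - N.rate r x * P x t))
      (Set.Ici 0) t

/-- The excess order `q = max_r deg a_r - 1` of the moment equations (truncated at `0`: if all
propensities are constant, the equations involve no moments of higher order). -/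
def excess (N : ReactionNetwork n nR) : ℕ :=
  (Finset.univ.sup fun r => (N.propensity r).totalDegree) - 1

/-- The generator `p ↦ ∑ r, a_r(x) (p(x + ν_r) - p(x))` on polynomials, which gives
`d/dt 𝔼[p] = 𝔼[generator p]` for solutions of the Chemical Master Equation. -/
noncomputable def generator (N : ReactionNetwork n nR) (p : MvPolynomial (Fin n) ℝ) :
    MvPolynomial (Fin n) ℝ :=
  ∑ r, N.propensity r *
    (MvPolynomial.aeval
      (fun i => MvPolynomial.X i + MvPolynomial.C ((N.change r i : ℤ) : ℝ)) p - p)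

end ReactionNetwork

/-- The set of states that are visited with positive probability at some time `t ≥ 0`. -/
def reachableSet {n : ℕ} (P : (Fin n → ℤ) → ℝ → ℝ) : Set (Fin n → ℤ) :=
  {x | 0 ≤ x ∧ ∃ t, 0 ≤ t ∧ 0 < P x t}

/-- The multi-indices in `ℤ₊ⁿ` of order at most `k`; they index the moments of order at most `k`
and the monomial basis of the polynomials of degree at most `k`. -/
abbrev MultiIndex (n k : ℕ) : Type := {a : Fin n →₀ ℕ // a.degree ≤ k}

noncomputable instance (n k : ℕ) : Fintype (MultiIndex n k) :=
  (Finsupp.finite_of_degree_le (σ := Fin n) k).fintype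

/-- A multi-index of order at most `k`, seen as one of order at most `k + l`. -/
def MultiIndex.lift {n k : ℕ} (l : ℕ) (a : MultiIndex n k) : MultiIndex n (k + l) :=
  ⟨a.1, a.2.trans (Nat.le_add_right k l)⟩

/-- The linear functional `p ↦ ∑_k p_k y_k` of a truncated moment vector `y`. -/
noncomputable def rieszFunctional {n k : ℕ} (y : MultiIndex n k → ℝ)
    (p : MvPolynomial (Fin n) ℝ) : ℝ :=
  ∑ a : MultiIndex n k, p.coeff a.1 * y a

/-- The coefficient matrix `A = [A_L  A_H]` of the moment equations of order at most `m`: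
row `i` holds the coefficients of the generator applied to the monomial `x ^ i`. -/
noncomputable def ReactionNetwork.momentODEMatrix {n nR : ℕ} (N : ReactionNetwork n nR) (m : ℕ) :
    Matrix (MultiIndex n m) (MultiIndex n (m + N.excess)) ℝ :=
  fun i a => (N.generator (MvPolynomial.monomial i.1 1)).coeff a.1

/-- The localizing matrix `M_f(y)`, that is `𝔼[f b bᵀ]` written in terms of the moments `y` of
order at most `k`, where `b` is the monomial basis of degree at most `⌊(k - deg f) / 2⌋`. -/
noncomputable def localizingMatrix {n k : ℕ} (f : MvPolynomial (Fin n) ℝ)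
    (y : MultiIndex n k → ℝ) :
    Matrix (MultiIndex n ((k - f.totalDegree) / 2)) (MultiIndex n ((k - f.totalDegree) / 2)) ℝ :=
  fun a b => rieszFunctional y
    (f * (MvPolynomial.monomial a.1 1 * MvPolynomial.monomial b.1 1))

/-- The convex cone `C(X)` of the moment vectors that satisfy the linear matrix inequalities of
the polynomials `f i` (polynomials that are non-negative on the reachable set `X`). -/
def momentCone {n k : ℕ} {ι : Type*} (f : ι → MvPolynomial (Fin n) ℝ) :
    Set (MultiIndex n k → ℝ) :=
  {y | ∀ i, (localizingMatrix (f i) y).PosSemidef}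

/-- A minimization problem over a set `feasible`. -/
structure MinProblem (V : Type*) where
  feasible : Set V
  objective : V → ℝ

namespace MinProblem

variable {V : Type*}

/-- The infimum of the problem (`⊤` if infeasible, `⊥` if unbounded below). -/
noncomputable def value (Q : MinProblem V) : EReal :=
  ⨅ v ∈ Q.feasible, ((Q.objective v : ℝ) : EReal)

/-- The set of optimal solutions. -/
def solutions (Q : MinProblem V) : Set V :=
  {v | v ∈ Q.feasible ∧ ∀ w ∈ Q.feasible, Q.objective v ≤ Q.objective w}

end MinProblem

/-- The data of a finite semidefinite program: finitely many real variables, a linear cost,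
finitely many affine equations and finitely many linear matrix inequalities
`constMat l + ∑ k, u k • coeffMat l k ⪰ 0` with symmetric matrices of finite size. -/
structure SemidefiniteProgram where
  numVars : ℕ
  numEqs : ℕ
  numLMIs : ℕ
  cost : Fin numVars → ℝ
  eqMat : Matrix (Fin numEqs) (Fin numVars) ℝ
  eqRhs : Fin numEqs → ℝ
  size : Fin numLMIs → ℕ
  constMat : ∀ l, Matrix (Fin (size l)) (Fin (size l)) ℝ
  coeffMat : ∀ l, Fin numVars → Matrix (Fin (size l)) (Fin (size l)) ℝ
  constMat_symm : ∀ l, (constMat l).IsSymm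
  coeffMat_symm : ∀ l k, (coeffMat l k).IsSymm

/-- The minimization problem that a semidefinite program describes. -/
def SemidefiniteProgram.problem (S : SemidefiniteProgram) : MinProblem (Fin S.numVars → ℝ) where
  feasible := {u | S.eqMat.mulVec u = S.eqRhs ∧
    ∀ l, (S.constMat l + ∑ k, u k • S.coeffMat l k).PosSemidef}
  objective := fun u => ∑ k, S.cost k * u k

/-- A problem `Q` is equivalent to a finite semidefinite program if there are such a program `S`
and a linear map from the variables of `S` to those of `Q` that maps the feasible set of `S` onto
that of `Q` and preserves the objective; and hence the two problems have the same infimum and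
their optimal solutions correspond. -/
def MinProblem.EquivalentToFiniteSDP {V : Type*} [AddCommGroup V] [Module ℝ V]
    (Q : MinProblem V) : Prop :=
  ∃ (S : SemidefiniteProgram) (φ : (Fin S.numVars → ℝ) →ₗ[ℝ] V),
    φ '' S.problem.feasible = Q.feasible ∧
    (∀ u ∈ S.problem.feasible, Q.objective (φ u) = S.problem.objective u) ∧
    S.problem.value = Q.value ∧
    φ '' S.problem.solutions = Q.solutions

/-- The optimal control problem restricted to polynomial trajectories of degree at most `d`:
minimize `y_j(t_f)` over the vectors `y` of univariate polynomials of degree at most `d`, indexed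
by the moments of order at most `m + q`, subject to the moment equations on `[0, t_T]`, the initial
condition `y(0) = y₀`, and `y(t) ∈ C(X)` for all `t ∈ [0, t_T]`. -/
noncomputable def ReactionNetwork.polynomialOCP {n nR : ℕ} (N : ReactionNetwork n nR) (m d : ℕ)
    {ι : Type*} (f : ι → MvPolynomial (Fin n) ℝ) (y₀ : MultiIndex n (m + N.excess) → ℝ)
    (tT tf : ℝ) (j : MultiIndex n (m + N.excess)) :
    MinProblem (MultiIndex n (m + N.excess) → Polynomial ℝ) where
  feasible := {y |
    (∀ a, (y a).natDegree ≤ d) ∧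
    (∀ t ∈ Set.Icc 0 tT, ∀ i : MultiIndex n m,
      HasDerivAt (fun s => (y (i.lift N.excess)).eval s)
        ((N.momentODEMatrix m).mulVec (fun a => (y a).eval t) i) t) ∧
    (∀ a, (y a).eval 0 = y₀ a) ∧
    (∀ t ∈ Set.Icc 0 tT, (fun a => (y a).eval t) ∈ momentCone f)}
  objective := fun y => (y j).eval tf

open Matrix

/-! ### Problems described by linear data on a finite-dimensional space -/

/-! Localizing matrices are linear in `y`, so along a trajectory of degree at most d each is a
symmetric matrix polynomial M(t) with entries of degree at most d. The only constraint that is not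
visibly of finite semidefinite type is positivity of M on all of [0, T]. A matrix Positivstellensatz
(`exists_intervalCertificate`) trades it for an identity M(t) = t S_G(t) + (T - t) S_H(t) with
positive semidefinite Gram matrices G, H of fixed size, which become extra variables. This identity,
the ODE and the initial condition are linear equations, infinitely many because of t, but spanned by
finitely many (`exists_finite_linear_system`).

The Positivstellensatz is proved by duality. The certificates form a closed convex cone, so a matrix
polynomial M outside it is separated from it by a functional f that is nonnegative on the cone and
negative at M; a small perturbation makes f positive on all certificates with (G, H) ≠ 0. The
symmetrized values of f on t^k E_{cc'} fill a block Hankel matrix A, positive definite, and its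
shift B with 0 ≤ B ≤ T A. Writing A = QᵀQ and B = Qᵀ diag(s) Q puts every s_l in [0, T], and the
Hankel shift forces Q_{l,(k,c)} = s_l^k v_l(c) with v_l(c) = Q_{l,(0,c)}. Hence the moments up to
order D come from atoms s_l with weights v_l v_lᵀ, and 2 f(M) = ∑ v_lᵀ M(s_l) v_l ≥ 0, a
contradiction. Taking Gram matrices of degree D, more than is sharp, lets all these moments be read
off from one block column of A. -/

/-- The optimal solutions and the infimum are determined by the feasible set and the objective. -/
theorem MinProblem.equivalentToFiniteSDP_of_image {V : Type*} [AddCommGroup V] [Module ℝ V]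
    (Q : MinProblem V) (S : SemidefiniteProgram) (φ : (Fin S.numVars → ℝ) →ₗ[ℝ] V)
    (himage : φ '' S.problem.feasible = Q.feasible)
    (hobj : ∀ u ∈ S.problem.feasible, Q.objective (φ u) = S.problem.objective u) :
    Q.EquivalentToFiniteSDP := by
  refine ⟨S, φ, himage, hobj, ?_, ?_⟩
  · rw [MinProblem.value, MinProblem.value, ← himage, iInf_image]
    exact iInf_congr fun u => iInf_congr fun hu => by rw [hobj u hu]
  · ext v
    simp only [MinProblem.solutions, ← himage, Set.mem_image, Set.mem_ofPred_eq]
    constructor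
    · rintro ⟨u, ⟨hu, hopt⟩, rfl⟩
      refine ⟨⟨u, hu, rfl⟩, ?_⟩
      rintro _ ⟨w, hw, rfl⟩
      rw [hobj u hu, hobj w hw]
      exact hopt w hw
    · rintro ⟨⟨u, hu, rfl⟩, hopt⟩
      refine ⟨u, ⟨hu, fun w hw => ?_⟩, rfl⟩
      rw [← hobj u hu, ← hobj w hw]
      exact hopt _ ⟨w, hw, rfl⟩

/-- Any family of linear equations in finitely many real variables has the same solutions as a
finite system. -/
theorem exists_finite_linear_system {N : ℕ} {I : Type*} (c : I → Fin N → ℝ) (b : I → ℝ) :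
    ∃ (k : ℕ) (A : Matrix (Fin k) (Fin N) ℝ) (r : Fin k → ℝ),
      ∀ u, A *ᵥ u = r ↔ ∀ i, c i ⬝ᵥ u = b i := by
  obtain ⟨k, g, hg⟩ := Submodule.fg_iff_exists_fin_generating_family.1
    (IsNoetherian.noetherian (Submodule.span ℝ (Set.range fun i => (c i, b i))))
  refine ⟨k, of fun l => (g l).1, fun l => (g l).2, fun u => ?_⟩
  -- The equations (c, b) satisfied by a fixed `u` form a subspace, so solving the family depends
  -- only on the span of the pairs (c i, b i).
  let E : Submodule ℝ ((Fin N → ℝ) × ℝ) :=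
    { carrier := {x | x.1 ⬝ᵥ u = x.2}
      add_mem' := fun {x y} hx hy => by
        simp only [Set.mem_ofPred_eq] at hx hy ⊢
        simp [add_dotProduct, hx, hy]
      zero_mem' := by simp
      smul_mem' := fun a x hx => by
        simp only [Set.mem_ofPred_eq] at hx ⊢
        simp [smul_dotProduct, hx] }
  have h1 : (of fun l => (g l).1) *ᵥ u = (fun l => (g l).2) ↔
      Submodule.span ℝ (Set.range g) ≤ E := by
    rw [Submodule.span_le, Set.range_subset_iff, funext_iff]
    rfl
  have h2 : (∀ i, c i ⬝ᵥ u = b i) ↔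
      Submodule.span ℝ (Set.range fun i => (c i, b i)) ≤ E := by
    rw [Submodule.span_le, Set.range_subset_iff]
    rfl
  rw [h1, h2, hg]

/-- A minimization problem is equivalent to a finite semidefinite program if its feasible set is
the image of a subset of a finite-dimensional space that is cut out by affine equations and finitely
many linear matrix inequalities, and its objective is linear on that space. -/
theorem MinProblem.equivalentToFiniteSDP_of_linear {V W I : Type*} [AddCommGroup V] [Module ℝ V]
    [AddCommGroup W] [Module ℝ W] [FiniteDimensional ℝ W] (Q : MinProblem V) (φ : W →ₗ[ℝ] V)
    (cost : W →ₗ[ℝ] ℝ) (eqn : I → W →ₗ[ℝ] ℝ) (rhs : I → ℝ) {Λ : Type*} [Fintype Λ]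
    {κ : Λ → Type*} [∀ l, Fintype (κ l)] (lmi : ∀ l, W →ₗ[ℝ] Matrix (κ l) (κ l) ℝ)
    (hsymm : ∀ l w, (lmi l w).IsSymm)
    (himage : φ '' {w | (∀ i, eqn i w = rhs i) ∧ ∀ l, (lmi l w).PosSemidef} = Q.feasible)
    (hobj : ∀ w, Q.objective (φ w) = cost w) : Q.EquivalentToFiniteSDP := by
  classical
  let e := (Module.finBasis ℝ W).equivFun.symm
  have he : ∀ u, e u = ∑ k, u k • Module.finBasis ℝ W k := fun u => by
    simp [e]
  obtain ⟨k, A, r, hA⟩ := exists_finite_linear_system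
    (fun i k => eqn i (Module.finBasis ℝ W k)) rhs
  let eΛ := Fintype.equivFin Λ
  let S : SemidefiniteProgram :=
    { numVars := Module.finrank ℝ W
      numEqs := k
      numLMIs := Fintype.card Λ
      cost := fun k => cost (Module.finBasis ℝ W k)
      eqMat := A
      eqRhs := r
      size := fun l => Fintype.card (κ (eΛ.symm l))
      constMat := fun _ => 0
      coeffMat := fun l k => (lmi (eΛ.symm l) (Module.finBasis ℝ W k)).submatrix
        (Fintype.equivFin _).symm (Fintype.equivFin _).symm
      constMat_symm := fun _ => isSymm_zero
      coeffMat_symm := fun l k => (hsymm _ _).submatrix _ }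
  have hfeas : S.problem.feasible =
      e ⁻¹' {w | (∀ i, eqn i w = rhs i) ∧ ∀ l, (lmi l w).PosSemidef} := by
    ext u
    change (A *ᵥ u = r ∧ ∀ l : Fin (Fintype.card Λ), ((0 : Matrix _ _ ℝ) + ∑ k, u k •
      (lmi (eΛ.symm l) (Module.finBasis ℝ W k)).submatrix (Fintype.equivFin _).symm
        (Fintype.equivFin _).symm).PosSemidef) ↔
      (∀ i, eqn i (e u) = rhs i) ∧ ∀ l, (lmi l (e u)).PosSemidef
    refine and_congr ?_ ?_
    · rw [hA]
      refine forall_congr' fun i => ?_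
      rw [he, map_sum]
      simp [dotProduct, mul_comm]
    · rw [eΛ.symm.surjective.forall]
      refine forall_congr' fun l => ?_
      rw [← posSemidef_submatrix_equiv (Fintype.equivFin (κ (eΛ.symm l))).symm]
      refine iff_of_eq (congrArg _ ?_)
      rw [he, map_sum]
      ext a b
      simp [Matrix.sum_apply]
      rfl
  have hcomp : (φ ∘ₗ e.toLinearMap) '' S.problem.feasible = Q.feasible := by
    rw [hfeas, LinearMap.coe_comp, Set.image_comp, ← himage]
    congr 1
    exact Set.image_preimage_eq _ e.surjective
  refine Q.equivalentToFiniteSDP_of_image S (φ ∘ₗ e.toLinearMap) hcomp fun u _ => ?_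
  change Q.objective (φ (e u)) = ∑ k, cost (Module.finBasis ℝ W k) * u k
  rw [hobj, he, map_sum]
  simp [mul_comm]

/-! ### Images of closed cones -/

/-- The image of a closed cone under a continuous linear map is closed if some continuous linear
functional is positive on the images of the nonzero elements of the cone. -/
theorem isClosed_image_cone {W E : Type*} [NormedAddCommGroup W] [NormedSpace ℝ W]
    [FiniteDimensional ℝ W] [TopologicalSpace E] [T2Space E] [AddCommGroup E] [Module ℝ E]
    (φ : W →L[ℝ] E) (g : E →L[ℝ] ℝ) {C : Set W} (hC : IsClosed C)
    (hsmul : ∀ c : ℝ, 0 ≤ c → ∀ x ∈ C, c • x ∈ C) (hpos : ∀ x ∈ C, x ≠ 0 → 0 < g (φ x)) :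
    IsClosed (φ '' C) := by
  have : ProperSpace W := FiniteDimensional.proper ℝ W
  obtain ⟨c, hc, hcle⟩ : ∃ c : ℝ, 0 < c ∧ ∀ x ∈ C ∩ Metric.sphere 0 1, c ≤ g (φ x) := by
    rcases (C ∩ Metric.sphere (0 : W) 1).eq_empty_or_nonempty with h | h
    · exact ⟨1, one_pos, by simp [h]⟩
    · obtain ⟨x, hx, hmin⟩ := ((isCompact_sphere (0 : W) 1).inter_left hC).exists_isMinOn h
        (g.continuous.comp φ.continuous).continuousOn
      refine ⟨g (φ x), hpos x hx.1 ?_, fun y hy => hmin hy⟩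
      rintro rfl
      simpa using hx.2
  have hbound : ∀ x ∈ C, c * ‖x‖ ≤ g (φ x) := by
    intro x hx
    rcases eq_or_ne x 0 with rfl | h0
    · simp
    · have hn : 0 < ‖x‖ := norm_pos_iff.2 h0
      have := hcle (‖x‖⁻¹ • x) ⟨hsmul _ (inv_nonneg.2 hn.le) x hx, by
        simp [norm_smul, inv_mul_cancel₀ hn.ne']⟩
      rw [map_smul, map_smul, smul_eq_mul, inv_mul_eq_div, le_div_iff₀ hn] at this
      exact this
  refine isClosed_of_closure_subset fun y hy => ?_
  -- Near `y` only cone elements of norm at most (g y + 1) / c matter, and the image of that compact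
  -- piece is closed.
  have hU : IsOpen {z | g z < g y + 1} := isOpen_lt g.continuous continuous_const
  have hmem : y ∈ closure ({z | g z < g y + 1} ∩ φ '' C) :=
    hU.inter_closure ⟨by simp, hy⟩
  have hK : IsCompact (φ '' (Metric.closedBall 0 ((g y + 1) / c) ∩ C)) :=
    ((isCompact_closedBall _ _).inter_right hC).image φ.continuous
  have hsub : {z | g z < g y + 1} ∩ φ '' C ⊆ φ '' (Metric.closedBall 0 ((g y + 1) / c) ∩ C) := by
    rintro _ ⟨hz, x, hx, rfl⟩
    refine ⟨x, ⟨?_, hx⟩, rfl⟩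
    rw [mem_closedBall_zero_iff, le_div_iff₀ hc, mul_comm]
    exact (hbound x hx).trans (le_of_lt hz)
  obtain ⟨x, hx, rfl⟩ := closure_minimal hsub hK.isClosed hmem
  exact ⟨x, hx.2, rfl⟩

/-! ### Simultaneous diagonalization -/

/-- A positive definite and a symmetric matrix are simultaneously diagonalized by a congruence. -/
theorem Matrix.PosDef.exists_simultaneous_diagonal {κ : Type*} [Fintype κ] [DecidableEq κ]
    {A B : Matrix κ κ ℝ} (hA : A.PosDef) (hB : Bᵀ = B) :
    ∃ (Q : Matrix κ κ ℝ) (s : κ → ℝ), IsUnit Q ∧ A = Qᵀ * Q ∧ B = Qᵀ * diagonal s * Q := by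
  obtain ⟨R, hR, rfl⟩ : ∃ R : Matrix κ κ ℝ, IsUnit R ∧ A = Rᵀ * R := by
    obtain ⟨R, hR⟩ : ∃ R, A = star R * R := by
      open scoped MatrixOrder in
      exact CStarAlgebra.nonneg_iff_eq_star_mul_self.mp hA.posSemidef.nonneg
    rw [star_eq_conjTranspose, conjTranspose_eq_transpose_of_trivial] at hR
    refine ⟨R, ?_, hR⟩
    have := hA.isUnit
    rw [hR] at this
    exact (IsUnit.mul_iff.1 this).2
  have hRd := (isUnit_iff_isUnit_det R).1 hR
  have hC : (R⁻¹ᵀ * B * R⁻¹).IsHermitian := by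
    rw [IsHermitian, conjTranspose_eq_transpose_of_trivial]
    simp [transpose_mul, hB, Matrix.mul_assoc]
  set U : Matrix κ κ ℝ := (hC.eigenvectorUnitary : Matrix κ κ ℝ)
  have hU1 : U * Uᵀ = 1 := by
    have := Unitary.coe_mul_star_self hC.eigenvectorUnitary
    rwa [Unitary.coe_star, star_eq_conjTranspose, conjTranspose_eq_transpose_of_trivial] at this
  have hspec : R⁻¹ᵀ * B * R⁻¹ = U * diagonal hC.eigenvalues * Uᵀ := by
    have := hC.spectral_theorem
    rw [Unitary.conjStarAlgAut_apply, star_eq_conjTranspose,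
      conjTranspose_eq_transpose_of_trivial] at this
    simpa using this
  have hRR : R⁻¹ * R = 1 := nonsing_inv_mul R hRd
  have hRR' : Rᵀ * R⁻¹ᵀ = 1 := by rw [← transpose_mul, hRR, transpose_one]
  refine ⟨Uᵀ * R, hC.eigenvalues, ?_, ?_, ?_⟩
  · refine IsUnit.mul ?_ hR
    exact IsUnit.of_mul_eq_one _ (mul_eq_one_comm.1 hU1)
  · rw [transpose_mul, transpose_transpose, Matrix.mul_assoc, ← Matrix.mul_assoc U, hU1,
      Matrix.one_mul]
  · have : B = Rᵀ * (R⁻¹ᵀ * B * R⁻¹) * R := by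
      rw [Matrix.mul_assoc _ _ R, Matrix.mul_assoc _ _ R, hRR, Matrix.mul_one,
        ← Matrix.mul_assoc, hRR', Matrix.one_mul]
    rw [transpose_mul, transpose_transpose]
    conv_lhs => rw [this, hspec]
    simp only [Matrix.mul_assoc]

/-! ### Matrix polynomials given by Gram matrices -/

section Gram

variable {ι : Type*} [Fintype ι] [DecidableEq ι] {D : ℕ}

/-- The matrix whose columns are the vector monomials `t ^ a • e_c` with `a ≤ D`. -/
def powerMatrix (ι : Type*) [DecidableEq ι] (D : ℕ) (t : ℝ) : Matrix (Fin (D + 1) × ι) ι ℝ :=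
  of fun p c => if p.2 = c then t ^ (p.1 : ℕ) else 0

/-- The value at `t` of the matrix polynomial with Gram matrix `G`. -/
def gramValue (G : Matrix (Fin (D + 1) × ι) (Fin (D + 1) × ι) ℝ) (t : ℝ) : Matrix ι ι ℝ :=
  (powerMatrix ι D t)ᵀ * G * powerMatrix ι D t

theorem gramValue_posSemidef {G : Matrix (Fin (D + 1) × ι) (Fin (D + 1) × ι) ℝ}
    (hG : G.PosSemidef) (t : ℝ) : (gramValue G t).PosSemidef := by
  have := hG.conjTranspose_mul_mul_same (powerMatrix ι D t)
  rwa [conjTranspose_eq_transpose_of_trivial] at this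

theorem gramValue_add (G H : Matrix (Fin (D + 1) × ι) (Fin (D + 1) × ι) ℝ) (t : ℝ) :
    gramValue (G + H) t = gramValue G t + gramValue H t := by
  simp [gramValue, Matrix.mul_add, Matrix.add_mul]

theorem gramValue_smul (c : ℝ) (G : Matrix (Fin (D + 1) × ι) (Fin (D + 1) × ι) ℝ) (t : ℝ) :
    gramValue (c • G) t = c • gramValue G t := by
  simp [gramValue]

theorem gramValue_eq_sum (G : Matrix (Fin (D + 1) × ι) (Fin (D + 1) × ι) ℝ) (t : ℝ) :
    gramValue G t =
      ∑ p, ∑ q, G p q • Matrix.single p.2 q.2 (t ^ ((p.1 : ℕ) + (q.1 : ℕ))) := by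
  ext c c'
  simp only [gramValue, powerMatrix, Matrix.mul_apply, Matrix.sum_apply, Matrix.smul_apply,
    Matrix.single_apply, transpose_apply, of_apply, Finset.sum_mul]
  rw [Finset.sum_comm]
  refine Finset.sum_congr rfl fun p _ => Finset.sum_congr rfl fun q _ => ?_
  by_cases h1 : p.2 = c <;> by_cases h2 : q.2 = c' <;> simp [h1, h2, pow_add]; ring

/-- A positive semidefinite Gram matrix of a matrix polynomial that vanishes at more points than
its degree allows is zero. -/
theorem eq_zero_of_gramValue_eq_zero {G : Matrix (Fin (D + 1) × ι) (Fin (D + 1) × ι) ℝ}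
    (hG : G.PosSemidef) {τ : Fin (D + 1) → ℝ} (hτ : Function.Injective τ)
    (h : ∀ j, gramValue G (τ j) = 0) : G = 0 := by
  -- For positive semidefinite `G`, a vector with vanishing quadratic form lies in the kernel.
  have hZ : ∀ j, G * powerMatrix ι D (τ j) = 0 := by
    intro j
    have hv : ∀ v : ι → ℝ, G *ᵥ (powerMatrix ι D (τ j) *ᵥ v) = 0 := by
      intro v
      rw [← hG.dotProduct_mulVec_zero_iff]
      have : v ⬝ᵥ (gramValue G (τ j) *ᵥ v) = 0 := by rw [h j]; simp
      rw [← this, gramValue, ← mulVec_mulVec, ← mulVec_mulVec, dotProduct_mulVec v, vecMul_transpose]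
      simp
    exact Matrix.ext_of_mulVec_single fun c => by
      rw [← mulVec_mulVec, hv, zero_mulVec]
  ext p q
  -- Each row of `G`, for a fixed index in `ι`, is the coefficient vector of a polynomial of degree
  -- at most `D` with `D + 1` distinct roots.
  have hrow : (fun a : Fin (D + 1) => G p (a, q.2)) = 0 := by
    refine eq_zero_of_forall_index_sum_mul_pow_eq_zero hτ fun j => ?_
    have := congr_fun (congr_fun (hZ j) p) q.2
    simpa [Matrix.mul_apply, powerMatrix, Fintype.sum_prod_type] using this
  exact congr_fun hrow q.1

end Gram

/-! ### Nonnegative matrix polynomials on an interval -/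

section Positivstellensatz

variable {ι : Type*} [Fintype ι] [DecidableEq ι] {D : ℕ} {T : ℝ}

/-- A sequence of moments with positive definite Hankel form whose localizing forms for `t` and
`T - t` are positive semidefinite is given up to order `D` by finitely many atoms in `[0, T]`. -/
theorem exists_atoms_of_hankel_posDef {h : ℕ → ι → ι → ℝ}
    (hsymm : ∀ k c c', h k c c' = h k c' c) {A B : Matrix (Fin (D + 1) × ι) (Fin (D + 1) × ι) ℝ}
    (hA : ∀ p q, A p q = h (p.1 + q.1) p.2 q.2) (hB : ∀ p q, B p q = h (p.1 + q.1 + 1) p.2 q.2)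
    (hApos : A.PosDef) (hBpos : B.PosSemidef) (hABpos : (T • A - B).PosSemidef) :
    ∃ (s : Fin (D + 1) × ι → ℝ) (v : Fin (D + 1) × ι → ι → ℝ), (∀ l, s l ∈ Set.Icc 0 T) ∧
      ∀ k ≤ D, ∀ c c', h k c c' = ∑ l, s l ^ k * (v l c * v l c') := by
  have hBt : Bᵀ = B := by
    ext p q
    rw [transpose_apply, hB, hB, hsymm, add_comm (q.1 : ℕ)]
  obtain ⟨Q, s, hQ, hAQ, hBQ⟩ := hApos.exists_simultaneous_diagonal hBt
  refine ⟨s, fun l c => Q l (0, c), fun l => ⟨?_, ?_⟩, ?_⟩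
  · have h1 : (star Q * diagonal s * Q).PosSemidef := by
      rwa [star_eq_conjTranspose, conjTranspose_eq_transpose_of_trivial, ← hBQ]
    rw [hQ.posSemidef_star_left_conjugate_iff, posSemidef_diagonal_iff] at h1
    exact h1 l
  · have h1 : (star Q * diagonal (fun l => T - s l) * Q).PosSemidef := by
      have : diagonal (fun l => T - s l) = T • (1 : Matrix (Fin (D + 1) × ι) _ ℝ) - diagonal s := by
        rw [smul_one_eq_diagonal, diagonal_sub]
      rw [star_eq_conjTranspose, conjTranspose_eq_transpose_of_trivial, this, Matrix.mul_sub,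
        Matrix.sub_mul, ← hBQ, Matrix.mul_smul, Matrix.mul_one, Matrix.smul_mul, ← hAQ]
      exact hABpos
    rw [hQ.posSemidef_star_left_conjugate_iff, posSemidef_diagonal_iff] at h1
    exact sub_nonneg.1 (h1 l)
  -- Column (a + 1, c) of A = QᵀQ is column (a, c) of B = Qᵀ diag(s) Q; cancel the invertible Qᵀ.
  · have hstep : ∀ (a b : Fin (D + 1)), (b : ℕ) = a + 1 → ∀ c l,
        Q l (b, c) = s l * Q l (a, c) := by
      intro a b hab c
      have hinj : Function.Injective Qᵀ.mulVec :=
        mulVec_injective_of_isUnit ((isUnit_transpose Q).2 hQ)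
      have : Qᵀ *ᵥ (fun l => Q l (b, c)) = Qᵀ *ᵥ (fun l => s l * Q l (a, c)) := by
        ext p
        have h1 : A p (b, c) = B p (a, c) := by
          rw [hA, hB, hab]; rfl
        rw [hAQ, hBQ, Matrix.mul_assoc, Matrix.mul_apply, Matrix.mul_apply] at h1
        simpa only [transpose_apply, mulVec, dotProduct, diagonal_mul] using h1
      exact congr_fun (hinj this)
    have hpow : ∀ (k : ℕ) (hk : k < D + 1) c l, Q l (⟨k, hk⟩, c) = s l ^ k * Q l (0, c) := by
      intro k
      induction k with
      | zero => intro hk c l; simp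
      | succ k ih =>
        intro hk c l
        rw [hstep ⟨k, by omega⟩ ⟨k + 1, hk⟩ rfl, ih, pow_succ]
        ring
    intro k hk c c'
    have h1 : A (⟨k, by omega⟩, c) (0, c') = h k c c' := by
      rw [hA]; simp
    rw [← h1, hAQ, Matrix.mul_apply]
    refine Finset.sum_congr rfl fun l _ => ?_
    rw [transpose_apply, hpow]
    ring

/-- Pairs `G` with the block Hankel matrix of the moments of `f`, shifted by `r`; the cases r = 0
and r = 1 give the quadratic forms of A and B below. -/
theorem map_smul_gramValue (f : (ℝ → Matrix ι ι ℝ) →ₗ[ℝ] ℝ) (r : ℕ)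
    (G : Matrix (Fin (D + 1) × ι) (Fin (D + 1) × ι) ℝ) :
    f (fun t => t ^ r • gramValue G t) =
      ∑ p, ∑ q, G p q * f (fun t => Matrix.single p.2 q.2 (t ^ ((p.1 : ℕ) + q.1 + r))) := by
  have : (fun t : ℝ => t ^ r • gramValue G t) =
      ∑ p, ∑ q, G p q • fun t : ℝ => Matrix.single p.2 q.2 (t ^ ((p.1 : ℕ) + q.1 + r)) := by
    funext t
    simp only [gramValue_eq_sum, Finset.sum_apply, Pi.smul_apply, Finset.smul_sum]
    refine Finset.sum_congr rfl fun p _ => Finset.sum_congr rfl fun q _ => ?_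
    simp only [smul_single, smul_eq_mul]
    congr 1
    ring
  simp [this, map_sum]

/-- A linear functional on matrix functions that is positive on `t • S_G(t) + (T - t) • S_H(t)` for
all positive semidefinite Gram matrices `G, H` that are not both zero is nonnegative on all matrix polynomials that
are positive semidefinite on `[0, T]`. -/
theorem map_nonneg_of_pos_on_squares (hT : 0 < T) (f : (ℝ → Matrix ι ι ℝ) →ₗ[ℝ] ℝ)
    (hf : ∀ G H : Matrix (Fin (D + 1) × ι) (Fin (D + 1) × ι) ℝ, G.PosSemidef → H.PosSemidef →
      (G, H) ≠ 0 → 0 < f (fun t => t • gramValue G t + (T - t) • gramValue H t))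
    {M : Matrix ι ι (Polynomial ℝ)} (hdeg : ∀ i j, (M i j).natDegree ≤ D)
    (hM : ∀ t ∈ Set.Icc 0 T, (M.map (Polynomial.eval t)).PosSemidef) (hsymm : M.IsSymm) :
    0 ≤ f (fun t => M.map (Polynomial.eval t)) := by
  -- Adding the transposed functional makes the moments symmetric in c, c' and only doubles the
  -- value on symmetric matrix functions.
  let τ : (ℝ → Matrix ι ι ℝ) →ₗ[ℝ] (ℝ → Matrix ι ι ℝ) :=
    { toFun := fun N t => (N t)ᵀ
      map_add' := fun _ _ => rfl
      map_smul' := fun _ _ => rfl }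
  let g := f + f ∘ₗ τ
  have hg : ∀ N : ℝ → Matrix ι ι ℝ, (∀ t, (N t).IsSymm) → g N = 2 * f N := by
    intro N hN
    have : τ N = N := funext hN
    simp [g, this, two_mul]
  let h : ℕ → ι → ι → ℝ := fun k c c' => g fun t => Matrix.single c c' (t ^ k)
  have hh : ∀ k c c', h k c c' = h k c' c := by
    intro k c c'
    have hτ : ∀ c c', τ (fun t => Matrix.single c c' (t ^ k)) =
        fun t => Matrix.single c' c (t ^ k) := fun c c' => funext fun t => transpose_single ..
    simp only [h, g, LinearMap.add_apply, LinearMap.comp_apply, hτ]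
    exact add_comm _ _
  let A : Matrix (Fin (D + 1) × ι) (Fin (D + 1) × ι) ℝ := of fun p q => h (p.1 + q.1) p.2 q.2
  let B : Matrix (Fin (D + 1) × ι) (Fin (D + 1) × ι) ℝ := of fun p q => h (p.1 + q.1 + 1) p.2 q.2
  have hAt : A.IsHermitian := by
    ext p q
    simp [A, hh _ p.2, add_comm]
  have hBt : B.IsHermitian := by
    ext p q
    simp [B, hh _ p.2, add_comm]
  have hps : ∀ w : Fin (D + 1) × ι → ℝ, (vecMulVec w w).PosSemidef := fun w => by
    simpa using posSemidef_vecMulVec_self_star w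
  have hgs : ∀ (w : Fin (D + 1) × ι → ℝ) t, (gramValue (vecMulVec w w) t).IsSymm := fun w t => by
    have := (gramValue_posSemidef (hps w) t).1
    rwa [IsHermitian, conjTranspose_eq_transpose_of_trivial] at this
  have hAw : ∀ w, w ⬝ᵥ (A *ᵥ w) = 2 * f (fun t => gramValue (vecMulVec w w) t) := by
    intro w
    rw [← hg _ (hgs w)]
    have := map_smul_gramValue g 0 (vecMulVec w w)
    simp only [pow_zero, one_smul, add_zero] at this
    rw [this]
    simp only [dotProduct, mulVec, Finset.mul_sum]
    refine Finset.sum_congr rfl fun p _ => Finset.sum_congr rfl fun q _ => ?_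
    simp [A, vecMulVec_apply, h]
    ring
  have hBw : ∀ w, w ⬝ᵥ (B *ᵥ w) = 2 * f (fun t => t • gramValue (vecMulVec w w) t) := by
    intro w
    rw [← hg _ fun t => (hgs w t).smul t]
    have := map_smul_gramValue g 1 (vecMulVec w w)
    simp only [pow_one] at this
    rw [this]
    simp only [dotProduct, mulVec, Finset.mul_sum]
    refine Finset.sum_congr rfl fun p _ => Finset.sum_congr rfl fun q _ => ?_
    simp [B, vecMulVec_apply, h]
    ring
  have hsplit : ∀ w : Fin (D + 1) × ι → ℝ,
      f (fun t => (T - t) • gramValue (vecMulVec w w) t) =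
      T * f (fun t => gramValue (vecMulVec w w) t) -
        f (fun t => t • gramValue (vecMulVec w w) t) := by
    intro w
    rw [← smul_eq_mul, ← map_smul, ← map_sub]
    congr 1
    funext t
    simp [sub_smul]
  have hne : ∀ w : Fin (D + 1) × ι → ℝ, w ≠ 0 → vecMulVec w w ≠ 0 := by
    intro w hw h0
    obtain ⟨p, hp⟩ := Function.ne_iff.1 hw
    have := congr_fun (congr_fun h0 p) p
    simp [vecMulVec_apply] at this
    exact hp this
  have hg0 : ∀ t, gramValue (0 : Matrix (Fin (D + 1) × ι) (Fin (D + 1) × ι) ℝ) t = 0 := by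
    simp [gramValue]
  have hBpos : ∀ w : Fin (D + 1) × ι → ℝ, w ≠ 0 →
      0 < f (fun t => t • gramValue (vecMulVec w w) t) := by
    intro w hw
    simpa [hg0] using hf _ 0 (hps w) .zero (by simp [hne w hw])
  have hABpos : ∀ w : Fin (D + 1) × ι → ℝ, w ≠ 0 →
      0 < f (fun t => (T - t) • gramValue (vecMulVec w w) t) := by
    intro w hw
    simpa [hg0] using hf 0 _ .zero (hps w) (by simp [hne w hw])
  obtain ⟨s, v, hs, hv⟩ := exists_atoms_of_hankel_posDef (T := T) hh (A := A) (B := B)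
    (fun _ _ => rfl) (fun _ _ => rfl)
    (.of_dotProduct_mulVec_pos hAt fun w hw => by
      -- The weights satisfy t + (T - t) = T, so the two strict inequalities add up to positivity of
      -- T times the form of A.
      have h1 := hBpos w hw
      have h2 := hABpos w hw
      rw [hsplit] at h2
      rw [star_trivial, hAw]
      have : 0 < T * f (fun t => gramValue (vecMulVec w w) t) := by linarith
      exact mul_pos two_pos (pos_of_mul_pos_right this hT.le))
    (.of_dotProduct_mulVec_nonneg hBt fun w => by
      rw [star_trivial, hBw]
      rcases eq_or_ne w 0 with rfl | hw
      · rw [← hBw]; simp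
      · exact (mul_pos two_pos (hBpos w hw)).le)
    (.of_dotProduct_mulVec_nonneg ((hAt.smul (star_trivial T)).sub hBt) fun w => by
      have key : star w ⬝ᵥ ((T • A - B) *ᵥ w) =
          2 * f (fun t => (T - t) • gramValue (vecMulVec w w) t) := by
        rw [star_trivial, sub_mulVec, smul_mulVec, dotProduct_sub, dotProduct_smul, hAw, hBw,
          hsplit, smul_eq_mul]
        ring
      rcases eq_or_ne w 0 with rfl | hw
      · simp
      · rw [key]
        exact (mul_pos two_pos (hABpos w hw)).le)
  have hMexp : (fun t => M.map (Polynomial.eval t)) = ∑ c, ∑ c', ∑ k ∈ Finset.range (D + 1),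
      (M c c').coeff k • fun t : ℝ => Matrix.single c c' (t ^ k) := by
    funext t
    ext c c'
    simp only [map_apply, Finset.sum_apply, Matrix.sum_apply, Pi.smul_apply, Matrix.smul_apply,
      Matrix.single_apply]
    rw [Finset.sum_eq_single c (by
        intro b _ hb; simp [hb]) (by simp),
      Finset.sum_eq_single c' (by
        intro b _ hb; simp [hb]) (by simp),
      Polynomial.eval_eq_sum_range' (Nat.lt_succ_of_le (hdeg c c'))]
    simp
  have hgM : g (fun t => M.map (Polynomial.eval t)) =
      ∑ l, v l ⬝ᵥ (M.map (Polynomial.eval (s l)) *ᵥ v l) := by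
    calc g (fun t => M.map (Polynomial.eval t))
        = ∑ c, ∑ c', ∑ k ∈ Finset.range (D + 1), (M c c').coeff k * h k c c' := by
          rw [hMexp]
          simp [map_sum, h]
      _ = ∑ c, ∑ c', ∑ l, (M c c').eval (s l) * (v l c * v l c') := by
          refine Finset.sum_congr rfl fun c _ => Finset.sum_congr rfl fun c' _ => ?_
          simp_rw [Polynomial.eval_eq_sum_range' (Nat.lt_succ_of_le (hdeg c c')), Finset.sum_mul]
          rw [Finset.sum_comm]
          refine Finset.sum_congr rfl fun k hk => ?_
          rw [hv k (Nat.lt_succ_iff.1 (Finset.mem_range.1 hk)), Finset.mul_sum]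
          exact Finset.sum_congr rfl fun l _ => by ring
      _ = ∑ l, v l ⬝ᵥ (M.map (Polynomial.eval (s l)) *ᵥ v l) := by
          simp only [dotProduct, mulVec, map_apply, Finset.mul_sum]
          rw [Finset.sum_comm (s := (Finset.univ : Finset (Fin (D + 1) × ι)))]
          refine Finset.sum_congr rfl fun c _ => ?_
          rw [Finset.sum_comm]
          refine Finset.sum_congr rfl fun l _ => Finset.sum_congr rfl fun c' _ => ?_
          ring
  have h2 : 0 ≤ g (fun t => M.map (Polynomial.eval t)) := by
    rw [hgM]
    exact Finset.sum_nonneg fun l _ => by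
      simpa using (hM (s l) (hs l)).dotProduct_mulVec_nonneg (v l)
  rw [hg _ fun t => by
    rw [IsSymm, ← Matrix.transpose_map, hsymm.eq]] at h2
  linarith

end Positivstellensatz

/-! ### The closed cone of interval certificates and the separation argument -/

section Certificate

variable {ι : Type*} [Fintype ι] [DecidableEq ι] {D : ℕ} {T : ℝ}

/-- The linear map `(G, H) ↦ t • S_G(t) + (T - t) • S_H(t)` from pairs of Gram matrices to matrix
functions. -/
def intervalCertificate (ι : Type*) [Fintype ι] [DecidableEq ι] (D : ℕ) (T : ℝ) :
    (Matrix (Fin (D + 1) × ι) (Fin (D + 1) × ι) ℝ ×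
      Matrix (Fin (D + 1) × ι) (Fin (D + 1) × ι) ℝ) →ₗ[ℝ] (ℝ → Matrix ι ι ℝ) where
  toFun G := fun t => t • gramValue G.1 t + (T - t) • gramValue G.2 t
  map_add' G H := by
    funext t
    simp only [Prod.fst_add, Prod.snd_add, gramValue_add, smul_add, Pi.add_apply]
    abel
  map_smul' c G := by
    funext t
    simp only [Prod.smul_fst, Prod.smul_snd, gramValue_smul, smul_add, Pi.smul_apply,
      RingHom.id_apply, smul_comm c]

theorem intervalCertificate_posSemidef {G : Matrix (Fin (D + 1) × ι) (Fin (D + 1) × ι) ℝ ×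
      Matrix (Fin (D + 1) × ι) (Fin (D + 1) × ι) ℝ} (h1 : G.1.PosSemidef) (h2 : G.2.PosSemidef)
    {t : ℝ} (ht : t ∈ Set.Icc 0 T) : (intervalCertificate ι D T G t).PosSemidef :=
  ((gramValue_posSemidef h1 t).smul ht.1).add
    ((gramValue_posSemidef h2 t).smul (sub_nonneg.2 ht.2))

theorem Matrix.isClosed_setOf_posSemidef {κ : Type*} [Fintype κ] :
    IsClosed {G : Matrix κ κ ℝ | G.PosSemidef} := by
  simp only [posSemidef_iff_dotProduct_mulVec, IsHermitian, Set.ofPred_and, Set.ofPred_forall]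
  refine (isClosed_eq continuous_id.matrix_conjTranspose continuous_id).inter
    (isClosed_iInter fun x => isClosed_le continuous_const ?_)
  exact continuous_const.dotProduct (continuous_id.matrix_mulVec continuous_const)

/-- The sum of the traces of the values at `D + 1` points inside `(0, T)`. -/
noncomputable def sampledTrace (ι : Type*) [Fintype ι] (D : ℕ) (T : ℝ) :
    (ℝ → Matrix ι ι ℝ) →L[ℝ] ℝ where
  toFun N := ∑ j : Fin (D + 1), (N (T * ((j + 1) / (D + 2)))).trace
  map_add' N N' := by simp [Finset.sum_add_distrib]
  map_smul' c N := by simp [Finset.mul_sum]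
  cont := continuous_finsetSum _ fun _ _ => (continuous_apply _).matrix_trace

/-- All sampled values are positive semidefinite, so a zero sum of traces makes each of them vanish.
Both weights are positive inside (0, T), hence both Gram polynomials vanish at `D + 1` points, which
forces G = 0 by `eq_zero_of_gramValue_eq_zero`. -/
theorem sampledTrace_pos (hT : 0 < T) {G : Matrix (Fin (D + 1) × ι) (Fin (D + 1) × ι) ℝ ×
      Matrix (Fin (D + 1) × ι) (Fin (D + 1) × ι) ℝ} (h1 : G.1.PosSemidef) (h2 : G.2.PosSemidef)
    (h0 : G ≠ 0) : 0 < sampledTrace ι D T (intervalCertificate ι D T G) := by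
  let τ : Fin (D + 1) → ℝ := fun j => T * ((j + 1) / (D + 2))
  have hτ0 : ∀ j, 0 < τ j := fun j => by positivity
  have hτT : ∀ j, 0 < T - τ j := fun j => by
    have : ((j : ℝ) + 1) / (D + 2) < 1 := by
      rw [div_lt_one (by positivity)]
      have : ((j : ℕ) : ℝ) < D + 1 := by exact_mod_cast j.2
      linarith
    have := mul_lt_mul_of_pos_left this hT
    simp only [τ]
    linarith
  have hτ : Function.Injective τ := by
    intro i j hij
    have h2 : (D : ℝ) + 2 ≠ 0 := by positivity
    have : (i : ℝ) = j := by
      simpa [τ, hT.ne', div_left_inj' h2] using hij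
    exact Fin.ext (by exact_mod_cast this)
  have hnn : ∀ j, 0 ≤ (intervalCertificate ι D T G (τ j)).trace := fun j =>
    (intervalCertificate_posSemidef h1 h2 ⟨(hτ0 j).le, (sub_pos.1 (hτT j)).le⟩).trace_nonneg
  change 0 < ∑ j, (intervalCertificate ι D T G (τ j)).trace
  refine lt_of_le_of_ne (Finset.sum_nonneg fun j _ => hnn j) fun hsum => h0 ?_
  have hz := (Finset.sum_eq_zero_iff_of_nonneg fun j _ => hnn j).1 hsum.symm
  have hz' : ∀ j, gramValue G.1 (τ j) = 0 ∧ gramValue G.2 (τ j) = 0 := by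
    intro j
    have h := hz j (Finset.mem_univ j)
    have e : (intervalCertificate ι D T G (τ j)).trace =
        τ j * (gramValue G.1 (τ j)).trace + (T - τ j) * (gramValue G.2 (τ j)).trace := by
      simp [intervalCertificate]
    have p1 := gramValue_posSemidef h1 (τ j)
    have p2 := gramValue_posSemidef h2 (τ j)
    rw [e, add_eq_zero_iff_of_nonneg (mul_nonneg (hτ0 j).le p1.trace_nonneg)
      (mul_nonneg (hτT j).le p2.trace_nonneg)] at h
    simp only [mul_eq_zero, (hτ0 j).ne', (hτT j).ne', false_or] at h
    exact ⟨p1.trace_eq_zero_iff.1 h.1, p2.trace_eq_zero_iff.1 h.2⟩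
  exact Prod.ext (eq_zero_of_gramValue_eq_zero h1 hτ fun j => (hz' j).1)
    (eq_zero_of_gramValue_eq_zero h2 hτ fun j => (hz' j).2)

-- `sampledTrace` is the functional that `isClosed_image_cone` asks for. The choice of matrix norm
-- is immaterial in finite dimension.
open scoped Matrix.Norms.Elementwise in
theorem isClosed_intervalCertificate_image (hT : 0 < T) :
    IsClosed (intervalCertificate ι D T '' {G | G.1.PosSemidef ∧ G.2.PosSemidef}) := by
  let φ : (Matrix (Fin (D + 1) × ι) (Fin (D + 1) × ι) ℝ ×
      Matrix (Fin (D + 1) × ι) (Fin (D + 1) × ι) ℝ) →L[ℝ] (ℝ → Matrix ι ι ℝ) :=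
    ⟨intervalCertificate ι D T, LinearMap.continuous_of_finiteDimensional _⟩
  exact isClosed_image_cone φ (sampledTrace ι D T)
    ((isClosed_setOf_posSemidef.preimage continuous_fst).inter
      (isClosed_setOf_posSemidef.preimage continuous_snd))
    (fun c hc G hG => ⟨hG.1.smul hc, hG.2.smul hc⟩)
    (fun G hG h0 => sampledTrace_pos hT hG.1 hG.2 h0)

/-- **Matrix Positivstellensatz on an interval**: a symmetric matrix polynomial is positive
semidefinite on `[0, T]` only if it is of the form `t • S_G(t) + (T - t) • S_H(t)` with positive
semidefinite Gram matrices `G, H` of a size given by its degree. -/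
theorem exists_intervalCertificate (hT : 0 < T) {M : Matrix ι ι (Polynomial ℝ)}
    (hsymm : M.IsSymm) (hdeg : ∀ i j, (M i j).natDegree ≤ D)
    (hM : ∀ t ∈ Set.Icc 0 T, (M.map (Polynomial.eval t)).PosSemidef) :
    ∃ G : Matrix (Fin (D + 1) × ι) (Fin (D + 1) × ι) ℝ ×
        Matrix (Fin (D + 1) × ι) (Fin (D + 1) × ι) ℝ,
      G.1.PosSemidef ∧ G.2.PosSemidef ∧
        intervalCertificate ι D T G = fun t => M.map (Polynomial.eval t) := by
  by_contra hcon
  let K : Set (ℝ → Matrix ι ι ℝ) :=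
    intervalCertificate ι D T '' {G | G.1.PosSemidef ∧ G.2.PosSemidef}
  have hzero : (0 : ℝ → Matrix ι ι ℝ) ∈ K := ⟨0, ⟨.zero, .zero⟩, map_zero _⟩
  have hsmul : ∀ c : ℝ, 0 ≤ c → ∀ N ∈ K, c • N ∈ K := by
    rintro c hc _ ⟨G, hG, rfl⟩
    exact ⟨c • G, ⟨hG.1.smul hc, hG.2.smul hc⟩, map_smul _ _ _⟩
  have hconv : Convex ℝ K := by
    rintro _ ⟨G, hG, rfl⟩ _ ⟨H, hH, rfl⟩ a b ha hb -
    refine ⟨a • G + b • H, ⟨(hG.1.smul ha).add (hH.1.smul hb), (hG.2.smul ha).add (hH.2.smul hb)⟩, ?_⟩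
    simp
  have : LocallyConvexSpace ℝ (Matrix ι ι ℝ) :=
    inferInstanceAs (LocallyConvexSpace ℝ (ι → ι → ℝ))
  obtain ⟨f, u, hu, hK⟩ := geometric_hahn_banach_point_closed hconv
    (isClosed_intervalCertificate_image hT)
    (x := fun t => M.map (Polynomial.eval t)) (by
      rintro ⟨G, hG, h⟩
      exact hcon ⟨G, hG.1, hG.2, h⟩)
  have hu0 : u < 0 := by simpa using hK 0 hzero
  -- A negative value could be scaled to equal `u` exactly, against the strict separation.
  have hfK : ∀ N ∈ K, 0 ≤ f N := by
    intro N hN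
    by_contra! hneg
    have := hK _ (hsmul (u / f N) (div_nonneg_of_nonpos hu0.le hneg.le) N hN)
    rw [map_smul, smul_eq_mul, div_mul_cancel₀ _ hneg.ne] at this
    exact lt_irrefl _ this
  set N₀ : ℝ → Matrix ι ι ℝ := fun t => M.map (Polynomial.eval t)
  -- Small enough that adding ε times the sampled trace keeps the value at `N₀` negative.
  let ε : ℝ := -f N₀ / (2 * (|sampledTrace ι D T N₀| + 1))
  have hfN : f N₀ < 0 := hu.trans hu0
  have hε : 0 < ε := div_pos (neg_pos.2 hfN) (by positivity)
  have hpos := map_nonneg_of_pos_on_squares hT (f + ε • sampledTrace ι D T : _ →L[ℝ] ℝ).toLinearMap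
    (D := D) (fun G H hG hH hne => by
      have h1 := hfK _ ⟨(G, H), ⟨hG, hH⟩, rfl⟩
      have h2 := mul_pos hε (sampledTrace_pos hT (G := (G, H)) hG hH hne)
      exact add_pos_of_nonneg_of_pos h1 h2) hdeg hM hsymm
  have hlt : ε * sampledTrace ι D T N₀ < -f N₀ := by
    have h1 : ε * (2 * (|sampledTrace ι D T N₀| + 1)) = -f N₀ :=
      div_mul_cancel₀ _ (by positivity)
    nlinarith [le_abs_self (sampledTrace ι D T N₀), abs_nonneg (sampledTrace ι D T N₀)]
  have : 0 ≤ f N₀ + ε * sampledTrace ι D T N₀ := hpos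
  linarith

end Certificate

/-! ### The moment problem -/

/-- The localizing matrix of a vector of polynomial moments. -/
noncomputable def polynomialLocalizingMatrix {n k : ℕ} (f : MvPolynomial (Fin n) ℝ)
    (y : MultiIndex n k → Polynomial ℝ) :
    Matrix (MultiIndex n ((k - f.totalDegree) / 2)) (MultiIndex n ((k - f.totalDegree) / 2))
      (Polynomial ℝ) :=
  fun a b => ∑ c : MultiIndex n k,
    (f * (MvPolynomial.monomial a.1 1 * MvPolynomial.monomial b.1 1)).coeff c.1 • y c

theorem polynomialLocalizingMatrix_map_eval {n k : ℕ} (f : MvPolynomial (Fin n) ℝ)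
    (y : MultiIndex n k → Polynomial ℝ) (t : ℝ) :
    (polynomialLocalizingMatrix f y).map (Polynomial.eval t) =
      localizingMatrix f fun a => (y a).eval t := by
  ext a b
  simp [polynomialLocalizingMatrix, localizingMatrix, rieszFunctional, Polynomial.eval_finsetSum]

theorem polynomialLocalizingMatrix_isSymm {n k : ℕ} (f : MvPolynomial (Fin n) ℝ)
    (y : MultiIndex n k → Polynomial ℝ) : (polynomialLocalizingMatrix f y).IsSymm := by
  ext a b
  simp only [polynomialLocalizingMatrix, transpose_apply]
  rw [mul_comm (MvPolynomial.monomial b.1 (1 : ℝ))]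

theorem natDegree_polynomialLocalizingMatrix_le {n k d : ℕ} (f : MvPolynomial (Fin n) ℝ)
    {y : MultiIndex n k → Polynomial ℝ} (hy : ∀ a, (y a).natDegree ≤ d) (a b) :
    (polynomialLocalizingMatrix f y a b).natDegree ≤ d :=
  Polynomial.natDegree_sum_le_of_forall_le _ _ fun c _ =>
    (Polynomial.natDegree_smul_le _ _).trans (hy c)

/-- The certificate identity is imposed at every real t, so that membership in the cone along the
interval becomes linear equations plus two matrix inequalities. -/
theorem forall_localizingMatrix_posSemidef_iff {n k d : ℕ} {T : ℝ} (hT : 0 < T)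
    (f : MvPolynomial (Fin n) ℝ) {y : MultiIndex n k → Polynomial ℝ}
    (hy : ∀ a, (y a).natDegree ≤ d) :
    (∀ t ∈ Set.Icc 0 T, (localizingMatrix f fun a => (y a).eval t).PosSemidef) ↔
      ∃ G, G.1.PosSemidef ∧ G.2.PosSemidef ∧ ∀ t,
        intervalCertificate (MultiIndex n ((k - f.totalDegree) / 2)) d T G t =
          localizingMatrix f fun a => (y a).eval t := by
  classical
  constructor
  · intro h
    simp only [← polynomialLocalizingMatrix_map_eval] at h ⊢
    obtain ⟨G, h1, h2, hG⟩ := exists_intervalCertificate hT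
      (polynomialLocalizingMatrix_isSymm f y) (natDegree_polynomialLocalizingMatrix_le f hy) h
    exact ⟨G, h1, h2, congr_fun hG⟩
  · rintro ⟨G, h1, h2, hG⟩ t ht
    rw [← hG]
    exact intervalCertificate_posSemidef h1 h2 ht

/-- Half of `G` works by symmetry. This lets the Gram variables be arbitrary square matrices H with
H + Hᵀ in the inequalities, whose coefficient matrices are then symmetric. -/
theorem Matrix.PosSemidef.exists_add_transpose {κ : Type*} [Fintype κ] {G : Matrix κ κ ℝ}
    (hG : G.PosSemidef) : ∃ H : Matrix κ κ ℝ, H + Hᵀ = G := by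
  refine ⟨(1 / 2 : ℝ) • G, ?_⟩
  have : Gᵀ = G := by
    rw [← conjTranspose_eq_transpose_of_trivial]; exact hG.1
  rw [transpose_smul, this, ← add_smul]
  norm_num

theorem mem_degreeLT_succ_iff {R : Type*} [Semiring R] {d : ℕ} {p : Polynomial R} :
    p ∈ Polynomial.degreeLT R (d + 1) ↔ p.natDegree ≤ d := by
  rw [Polynomial.mem_degreeLT, Polynomial.degree_lt_iff_coeff_zero,
    Polynomial.natDegree_le_iff_coeff_eq_zero]
  rfl

theorem mainTheorem7 {n nR : ℕ} (N : ReactionNetwork n nR)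
    (init : (Fin n → ℤ) → ℝ) (P : (Fin n → ℤ) → ℝ → ℝ) (hP : N.IsCMESolution init P)
    (m np : ℕ) (f : Fin (np + 1) → MvPolynomial (Fin n) ℝ)
    (hf : ∀ i, ∀ x ∈ reachableSet P, 0 ≤ MvPolynomial.eval (fun s => (x s : ℝ)) (f i))
    (hdeg : ∀ i, (f i).totalDegree ≤ m + N.excess)
    (y₀ : MultiIndex n (m + N.excess) → ℝ) (tT tf : ℝ) (htT : 0 < tT)
    (htf : tf ∈ Set.Icc 0 tT) (j : MultiIndex n (m + N.excess)) (d : ℕ) :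
    (N.polynomialOCP m d f y₀ tT tf j).EquivalentToFiniteSDP := by
  let β : Fin (np + 1) → Type := fun l => MultiIndex n ((m + N.excess - (f l).totalDegree) / 2)
  let κ : Fin (np + 1) × Bool → Type := fun l => Fin (d + 1) × β l.1
  -- Variables: the trajectory (`degreeLT` is strict, hence `d + 1`) and two free matrices per
  -- polynomial; `false` belongs to the weight t, `true` to tT - t.
  let W := (MultiIndex n (m + N.excess) → Polynomial.degreeLT ℝ (d + 1)) ×
    (∀ l, Matrix (κ l) (κ l) ℝ)
  have : FiniteDimensional ℝ (Polynomial.degreeLT ℝ (d + 1)) :=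
    .of_injective (Polynomial.degreeLTEquiv ℝ (d + 1)).toLinearMap (LinearEquiv.injective _)
  let Y : MultiIndex n (m + N.excess) → W →ₗ[ℝ] Polynomial ℝ := fun a =>
    (Polynomial.degreeLT ℝ (d + 1)).subtype ∘ₗ LinearMap.proj a ∘ₗ LinearMap.fst ℝ _ _
  let S : ∀ l, W →ₗ[ℝ] Matrix (κ l) (κ l) ℝ := fun l =>
    (LinearMap.id + (transposeLinearEquiv (κ l) (κ l) ℝ ℝ).toLinearMap) ∘ₗ LinearMap.proj l ∘ₗ
      LinearMap.snd ℝ _ _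
  have hS : ∀ l w, S l w = w.2 l + (w.2 l)ᵀ := fun _ _ => rfl
  have hY : ∀ w a, (Y a w).natDegree ≤ d := fun w a => by
    exact mem_degreeLT_succ_iff.1 (w.1 a).2
  let E : ∀ l, W →ₗ[ℝ] (ℝ → Matrix (β l) (β l) ℝ) := fun l =>
    intervalCertificate (β l) d tT ∘ₗ LinearMap.prod (S (l, false)) (S (l, true))
  -- One equation per time and moment for the ODE, per moment for the initial values, and per real t
  -- and matrix entry for the certificates.
  let I := (Set.Icc 0 tT × MultiIndex n m) ⊕ MultiIndex n (m + N.excess) ⊕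
    (Σ l, ℝ × β l × β l)
  let eqn : I → W →ₗ[ℝ] ℝ := Sum.elim
    (fun i => Polynomial.leval i.1.1 ∘ₗ Polynomial.derivative ∘ₗ Y (i.2.lift N.excess) -
      ∑ a, N.momentODEMatrix m i.2 a • Polynomial.leval i.1.1 ∘ₗ Y a)
    (Sum.elim (fun a => Polynomial.leval 0 ∘ₗ Y a)
      (fun i => entryLinearMap ℝ ℝ i.2.2.1 i.2.2.2 ∘ₗ LinearMap.proj i.2.1 ∘ₗ E i.1 -
        ∑ a : MultiIndex n (m + N.excess), (f i.1 * (MvPolynomial.monomial i.2.2.1.1 1 *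
          MvPolynomial.monomial i.2.2.2.1 1)).coeff a.1 • Polynomial.leval i.2.1 ∘ₗ Y a))
  let rhs : I → ℝ := Sum.elim (fun _ => 0) (Sum.elim y₀ fun _ => 0)
  have heqn : ∀ w, (∀ i, eqn i w = rhs i) ↔
      (∀ t ∈ Set.Icc 0 tT, ∀ i : MultiIndex n m,
        HasDerivAt (fun s => (Y (i.lift N.excess) w).eval s)
          ((N.momentODEMatrix m).mulVec (fun a => (Y a w).eval t) i) t) ∧
      (∀ a, (Y a w).eval 0 = y₀ a) ∧
      (∀ l t, intervalCertificate (β l) d tT (S (l, false) w, S (l, true) w) t =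
        localizingMatrix (f l) fun a => (Y a w).eval t) := by
    intro w
    simp only [I, Sum.forall]
    refine and_congr ?_ (and_congr Iff.rfl ?_)
    · have key : ∀ t (i : MultiIndex n m),
          (Polynomial.derivative (Y (i.lift N.excess) w)).eval t -
            (N.momentODEMatrix m).mulVec (fun a => (Y a w).eval t) i = 0 ↔
          HasDerivAt (fun s => (Y (i.lift N.excess) w).eval s)
            ((N.momentODEMatrix m).mulVec (fun a => (Y a w).eval t) i) t := by
        intro t i
        rw [sub_eq_zero]
        exact ⟨fun h => h ▸ Polynomial.hasDerivAt _ t, fun h => (Polynomial.hasDerivAt _ t).unique h⟩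
      rw [Prod.forall, Subtype.forall]
      refine forall₃_congr fun t ht i => ?_
      rw [← key]
      simp [eqn, rhs, mulVec, dotProduct]
    · rw [Sigma.forall]
      refine forall_congr' fun l => ?_
      rw [Prod.forall]
      refine forall_congr' fun t => ?_
      rw [Prod.forall, ← Matrix.ext_iff]
      refine forall₂_congr fun b c => ?_
      rw [← sub_eq_zero (b := localizingMatrix _ _ b c)]
      simp [eqn, rhs, E, localizingMatrix, rieszFunctional]
  refine MinProblem.equivalentToFiniteSDP_of_linear _ (LinearMap.pi Y)
    (Polynomial.leval tf ∘ₗ Y j) eqn rhs S (fun l w => ?_) ?_ (fun w => rfl)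
  · rw [hS]
    exact isSymm_add_transpose_self _
  · ext y
    constructor
    · rintro ⟨w, ⟨hw, hpsd⟩, rfl⟩
      obtain ⟨h1, h2, h3⟩ := (heqn w).1 hw
      refine ⟨hY w, h1, h2, fun t ht l => ?_⟩
      exact (forall_localizingMatrix_posSemidef_iff htT (f l) (hY w)).2
        ⟨_, hpsd (l, false), hpsd (l, true), h3 l⟩ t ht
    · rintro ⟨h0, h1, h2, h3⟩
      have h3' := fun l => (forall_localizingMatrix_posSemidef_iff htT (f l) h0).1
        fun t ht => h3 t ht l
      choose G hG1 hG2 hG using h3'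
      choose H₁ hH₁ using fun l => (hG1 l).exists_add_transpose
      choose H₂ hH₂ using fun l => (hG2 l).exists_add_transpose
      let w : W := (fun a => ⟨y a, mem_degreeLT_succ_iff.2 (h0 a)⟩,
        fun l => match l with
          | (l, false) => H₁ l
          | (l, true) => H₂ l)
      have hw1 : ∀ l, S (l, false) w = (G l).1 := hH₁
      have hw2 : ∀ l, S (l, true) w = (G l).2 := hH₂
      refine ⟨w, ⟨(heqn w).2 ⟨h1, h2, fun l t => ?_⟩, ?_⟩, rfl⟩
      · rw [hw1, hw2]
        exact hG l t
      · rintro ⟨l, _ | _⟩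
        · rw [hw1]; exact hG1 l
        · rw [hw2]; exact hG2 l
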